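/- **Theorem (fractional Gagliardo–Nirenberg inequality).** Let $n\ge 1$ be an integer, $0<s<n$ and $1<p<\frac ns$. For $u\in L^2(\mathbb R^n)$ (complex valued) let $\sqrt{-\Delta}^{\,s}u=(-\Delta)^{s/2}u:=\mathcal F^{-1}(|\xi|^s\,\mathcal F u)$ as a tempered distribution, where $\mathcal F u(\xi)=\int_{\mathbb R^n} u(x)e^{-ix\cdot\xi}\,dx$, extended to $L^2$ by Plancherel. All integrals below take values in $[0,\infty]$, with $0^t=\infty$ and $\infty^t=0$ for $t<0$, and $0\cdot\infty=0$. (i) Let $m,q,\theta\in\mathbb R\setminus\{0\}$ and $r\in\mathbb R$ satisfy $q\neq m\theta>0$, $1<\frac{r}{q-m\theta}$ and $$m\theta\Big(\frac1p-\frac sn\Big)+\frac{q-m\theta}{r}=1 .$$ Then there is a constant $C>0$, independent of $u$, such that $$\int_{\mathbb R^n}|u|^q\,dx\le C\Big(\int_{\mathbb R^n}\big|\sqrt{-\Delta}^{\,s}u\big|^p\,dx\Big)^{\frac{m\theta}{p}}\Big(\int_{\mathbb R^n}|u|^r\,dx\Big)^{\frac{q-m\theta}{r}}$$ for every $u\in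 L^2(\mathbb R^n)$ with $\sqrt{-\Delta}^{\,s}u\in L^p(\mathbb R^n)$ (and $u\neq0$ if $q<0$). (ii) In particular, for $m=q$: let $q,\theta\in\mathbb R\setminus\{0\}$ and $r\in\mathbb R$ satisfy $q\ne q\theta>0$, $1<\frac{r}{q-q\theta}$ and $$\theta\Big(\frac1p-\frac sn\Big)+\frac{1-\theta}{r}=\frac1q .$$ Then there is a constant $C>0$, independent of $u$, such that $$\Big(\int_{\mathbb R^n}|u|^q\,dx\Big)^{\frac1q}\le C\Big(\int_{\mathbb R^n}\big|\sqrt{-\Delta}^{\,s}u\big|^p\,dx\Big)^{\frac{\theta}{p}}\Big(\int_{\mathbb R^n}|u|^r\,dx\Big)^{\frac{1-\theta}{r}}$$ for every $u\in L^2(\mathbb R^n)$ with $\sqrt{-\Delta}^{\,s}u\in L^p(\mathbb R^n)$ (and $u\neq0$ if $q<0$). -/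

import Mathlib

open MeasureTheory FourierTransform SchwartzMap
open scoped ENNReal

/-- `f` represents `√(-Δ)^s u = 𝓕⁻¹(|·|^s 𝓕 u)` for `u ∈ L²(ℝⁿ)`, as a tempered distribution:
the Fourier transform of `f` is the function `|ξ|^s û(ξ)`, i.e.
`∫ f · 𝓕 φ = ∫ |ξ|^s û(ξ) φ(ξ) dξ` for every Schwartz function `φ`.
Here `𝓕 u` is the `L²` Fourier transform. Mathlib's Fourier transform has the kernel
`exp (-2πi x·ξ)`, so that the symbol `|ξ|^s` of the convention `exp (-i x·ξ)` reads `(2π|ξ|)^s`.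
It is used for `f ∈ L^p`, `1 < p < ∞`, where both integrals converge absolutely;
such an `f` is determined by `u` up to a null set. -/
def IsFractionalLaplacian {n : ℕ} (s : ℝ)
    (u : Lp ℂ 2 (volume : Measure (EuclideanSpace ℝ (Fin n))))
    (f : EuclideanSpace ℝ (Fin n) → ℂ) : Prop :=
  ∀ φ : 𝓢(EuclideanSpace ℝ (Fin n), ℂ),
    ∫ x, f x * (𝓕 φ) x =
      ∫ ξ, (((2 * Real.pi * ‖ξ‖) ^ s : ℝ) : ℂ) *
        (𝓕 u : Lp ℂ 2 (volume : Measure (EuclideanSpace ℝ (Fin n)))) ξ * φ ξ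

/-!
The inequality is Hölder's inequality followed by the fractional Sobolev inequality.

Put `a = m θ` and `1 / R = 1 / p - s / n`. The scaling condition says that `R / a` and
`r / (q - a)` are conjugate exponents, so for `q > 0` Hölder's inequality
(`lintegral_rpow_add_le_mul`) bounds `∫ |u|^q = ∫ |u|^a |u|^(q - a)` by powers of `∫ |u|^R` and
`∫ |u|^r`, and the Sobolev inequality `‖u‖_R ≤ C ‖(-Δ)^(s/2) u‖_p`
(`lintegral_rpow_le_of_isFractionalLaplacian`) replaces the first. For `q < 0` also `r < 0`, and as
`u ∈ L²` is small on a set of infinite measure, `∫ |u|^r = ∞`; the right-hand side is then infinite,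
because by the Sobolev inequality `(-Δ)^(s/2) u = 0` only for `u = 0`.

For the Sobolev inequality, write a constant as
`∫₀^∞ b^(s/2 - 1) (2π|ξ|)^s exp (-b |ξ|²) db` (`integral_Ioi_rpow_mul_exp_neg_mul_sq`). Multiplying
`û` by this and pairing with Schwartz functions shows that `u` is a superposition of heat flows of
`f = (-Δ)^(s/2) u`; only the resulting bound
`|u| ≤ C ∫₀^∞ b^(s/2 - 1) (G_b * |f|) db` almost everywhere is needed
(`enorm_integral_mul_le_lintegral_heatPotential`, `ae_enorm_le_of_forall_schwartz`).
The right-hand side is bounded in `L^R` by Hedberg's argument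
(`lintegral_heatPotential_rpow_le`): `G_b * |f|` is at most a constant times the maximal function
`M f`, and at most a constant times `b^(-n/(2p)) ‖f‖_p`. Splitting the `b`-integral where the two
bounds agree gives `C (M f)^(1 - s p / n) ‖f‖_p^(s p / n)`, and the `L^R` norm of this is controlled
by the maximal theorem on `L^p` (`lintegral_maximalFunction_rpow_le`), which follows from Vitali's
covering lemma and the layer cake formula.
-/

/-! ### Integrals of powers and the layer cake formula -/

section Integrals
open Set

theorem lintegral_Ioo_rpow_sub_one {a R : ℝ} (ha : 0 < a) (hR : 0 ≤ R) :
    ∫⁻ t in Ioo 0 R, ENNReal.ofReal (t ^ (a - 1)) = ENNReal.ofReal (R ^ a / a) := by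
  have hi : IntervalIntegrable (fun t : ℝ => t ^ (a - 1)) volume 0 R :=
    intervalIntegral.intervalIntegrable_rpow' (by linarith)
  rw [← ofReal_integral_eq_lintegral_ofReal, ← integral_Ioc_eq_integral_Ioo,
    ← intervalIntegral.integral_of_le hR, integral_rpow (Or.inl (by linarith))]
  · simp [Real.zero_rpow ha.ne']
  · exact ((intervalIntegrable_iff_integrableOn_Ioc_of_le hR).1 hi).mono_set Ioo_subset_Ioc_self
  · filter_upwards [ae_restrict_mem measurableSet_Ioo] with t ht
    exact Real.rpow_nonneg ht.1.le _

theorem lintegral_Ioi_rpow_neg_sub_one {a R : ℝ} (ha : 0 < a) (hR : 0 < R) :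
    ∫⁻ t in Ioi R, ENNReal.ofReal (t ^ (-a - 1)) = ENNReal.ofReal (R ^ (-a) / a) := by
  rw [← ofReal_integral_eq_lintegral_ofReal, integral_Ioi_rpow_of_lt (by linarith) hR]
  · congr 1
    rw [sub_add_cancel, neg_div_neg_eq]
  · exact integrableOn_Ioi_rpow_of_lt (by linarith) hR
  · filter_upwards [ae_restrict_mem measurableSet_Ioi] with t ht
    exact Real.rpow_nonneg (hR.trans ht).le _

/-- The layer cake formula for a single value `c`; it also holds for `c = ∞`, so that it can be
integrated against functions with values in `[0, ∞]`. -/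
theorem lintegral_Ioi_indicator_rpow_sub_one {a : ℝ} (ha : 0 < a) (c : ℝ≥0∞) :
    ∫⁻ t in Ioi (0 : ℝ), (if ENNReal.ofReal t < c then ENNReal.ofReal (t ^ (a - 1)) else 0) =
      c ^ a / ENNReal.ofReal a := by
  have key : ∀ R : ℝ, 0 ≤ R →
      ∫⁻ t in Ioi (0 : ℝ), (if ENNReal.ofReal t < ENNReal.ofReal R then
        ENNReal.ofReal (t ^ (a - 1)) else 0) = ENNReal.ofReal R ^ a / ENNReal.ofReal a := by
    intro R hR
    rw [ENNReal.ofReal_rpow_of_nonneg hR ha.le, ← ENNReal.ofReal_div_of_pos ha,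
      ← lintegral_Ioo_rpow_sub_one ha hR, ← Iio_inter_Ioi, ← setLIntegral_indicator measurableSet_Iio]
    refine setLIntegral_congr_fun measurableSet_Ioi fun t ht => ?_
    have : ENNReal.ofReal t < ENNReal.ofReal R ↔ t < R :=
      ENNReal.ofReal_lt_ofReal_iff_of_nonneg (le_of_lt ht)
    simp [indicator, this]
  by_cases hc : c = ∞
  · subst hc
    rw [ENNReal.top_rpow_of_pos ha, ENNReal.top_div_of_ne_top ENNReal.ofReal_ne_top, eq_top_iff]
    have hlim : Filter.Tendsto (fun k : ℕ => ENNReal.ofReal (k : ℝ) ^ a / ENNReal.ofReal a)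
        Filter.atTop (nhds ∞) := by
      have h1 : Filter.Tendsto (fun k : ℕ => ENNReal.ofReal (((k : ℝ) ^ a) / a)) Filter.atTop
          (nhds ∞) := by
        apply ENNReal.tendsto_ofReal_atTop.comp
        exact ((tendsto_rpow_atTop ha).comp tendsto_natCast_atTop_atTop).atTop_div_const ha
      refine h1.congr fun k => ?_
      rw [ENNReal.ofReal_div_of_pos ha, ENNReal.ofReal_rpow_of_nonneg (Nat.cast_nonneg k) ha.le]
    refine le_of_tendsto' hlim fun k => ?_
    rw [← key k (Nat.cast_nonneg k)]
    refine lintegral_mono fun t => ?_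
    simp only [ENNReal.ofReal_lt_top, if_true]
    split_ifs <;> simp
  · have := key c.toReal ENNReal.toReal_nonneg
    rwa [ENNReal.ofReal_toReal hc] at this

end Integrals

/-! ### The Hardy–Littlewood maximal function -/

section Maximal
open Set Metric Module

/-- The centred Hardy–Littlewood maximal function of `g`. The integral over the ball of radius `ρ`
is divided by `ρ ^ finrank ℝ E` instead of the measure of the ball; for a Haar measure this changes
the maximal function only by a constant factor. -/
noncomputable def maximalFunction {E : Type*} [NormedAddCommGroup E] [NormedSpace ℝ E]
    [MeasurableSpace E] (μ : Measure E) (g : E → ℝ≥0∞) (x : E) : ℝ≥0∞ :=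
  ⨆ ρ : Ioi (0 : ℝ), (∫⁻ y in ball x ρ, g y ∂μ) / ENNReal.ofReal ((ρ : ℝ) ^ finrank ℝ E)

variable {E : Type*} [NormedAddCommGroup E] [NormedSpace ℝ E] [MeasurableSpace E]
  {μ : Measure E} {g : E → ℝ≥0∞}

theorem setLIntegral_ball_le_maximalFunction (x : E) {ρ : ℝ} (hρ : 0 < ρ) :
    ∫⁻ y in ball x ρ, g y ∂μ ≤ maximalFunction μ g x * ENNReal.ofReal (ρ ^ finrank ℝ E) := by
  have h0 : ENNReal.ofReal (ρ ^ finrank ℝ E) ≠ 0 := by simpa using pow_pos hρ _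
  rw [← ENNReal.div_le_iff h0 ENNReal.ofReal_ne_top]
  exact le_iSup (fun ρ : Ioi (0 : ℝ) =>
    (∫⁻ y in ball x ρ, g y ∂μ) / ENNReal.ofReal ((ρ : ℝ) ^ finrank ℝ E)) ⟨ρ, hρ⟩

theorem lt_maximalFunction_iff {x : E} {t : ℝ≥0∞} :
    t < maximalFunction μ g x ↔
      ∃ ρ : ℝ, 0 < ρ ∧ t * ENNReal.ofReal (ρ ^ finrank ℝ E) < ∫⁻ y in ball x ρ, g y ∂μ := by
  rw [maximalFunction, lt_iSup_iff]
  constructor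
  · rintro ⟨ρ, h⟩
    have h0 : ENNReal.ofReal ((ρ : ℝ) ^ finrank ℝ E) ≠ 0 := by simpa using pow_pos ρ.2 _
    exact ⟨ρ, ρ.2, (ENNReal.lt_div_iff_mul_lt (Or.inl h0) (Or.inl ENNReal.ofReal_ne_top)).1 h⟩
  · rintro ⟨ρ, hρ, h⟩
    have h0 : ENNReal.ofReal ((ρ : ℝ) ^ finrank ℝ E) ≠ 0 := by simpa using pow_pos hρ _
    exact ⟨⟨ρ, hρ⟩, (ENNReal.lt_div_iff_mul_lt (Or.inl h0) (Or.inl ENNReal.ofReal_ne_top)).2 h⟩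

variable [BorelSpace E]

theorem measurable_maximalFunction : Measurable (maximalFunction μ g) := by
  refine LowerSemicontinuous.measurable ?_
  intro x t ht
  obtain ⟨ρ, hρ, h⟩ := lt_maximalFunction_iff.1 ht
  -- by continuity from below a slightly smaller ball already carries enough mass
  obtain ⟨v, hv, hvρ, hvlim⟩ := exists_seq_strictMono_tendsto ρ
  have hU : ball x ρ = ⋃ k, ball x (v k) := by
    ext y
    simp only [mem_ball, mem_iUnion]
    refine ⟨fun hy => ?_, fun ⟨k, hk⟩ => hk.trans (hvρ k)⟩
    exact (hvlim.eventually_const_lt hy).exists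
  have hmono : Monotone fun k => ball x (v k) := fun i j hij => ball_subset_ball (hv.monotone hij)
  have hsup : ∫⁻ y in ball x ρ, g y ∂μ = ⨆ k, ∫⁻ y in ball x (v k), g y ∂μ := by
    rw [hU, setLIntegral_iUnion_of_directed _ hmono.directed_le]
  rw [hsup, lt_iSup_iff] at h
  obtain ⟨k, hk⟩ := h
  filter_upwards [ball_mem_nhds x (sub_pos.2 (hvρ k))] with x' hx'
  refine lt_maximalFunction_iff.2 ⟨ρ, hρ, hk.trans_le (lintegral_mono_set ?_)⟩
  refine ball_subset_ball' ?_
  rw [mem_ball, dist_comm] at hx'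
  linarith

variable [FiniteDimensional ℝ E] [Nontrivial E] [μ.IsAddHaarMeasure]

/-- The maximal function is of weak type `(1, 1)`: Vitali's lemma selects disjoint balls among
those on which the average of `g` exceeds `t`, and their fivefold enlargements cover the set. -/
theorem measure_lt_maximalFunction_le (g : E → ℝ≥0∞) {t : ℝ≥0∞} (ht : t ≠ 0) (ht' : t ≠ ∞) :
    μ {x | t < maximalFunction μ g x} ≤
      ENNReal.ofReal (5 ^ finrank ℝ E) * μ (ball 0 1) * ((∫⁻ y, g y ∂μ) / t) := by
  have hd : finrank ℝ E ≠ 0 := finrank_pos.ne'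
  have hball : μ (ball (0 : E) 1) ≠ 0 := (measure_ball_pos μ 0 one_pos).ne'
  by_cases hg : ∫⁻ y, g y ∂μ = ∞
  · rw [hg, ENNReal.top_div_of_ne_top ht', ENNReal.mul_top]
    · exact le_top
    · exact mul_ne_zero (by simp) hball
  have hex : ∀ x ∈ {x | t < maximalFunction μ g x}, ∃ ρ : ℝ, 0 < ρ ∧
      t * ENNReal.ofReal (ρ ^ finrank ℝ E) < ∫⁻ y in ball x ρ, g y ∂μ :=
    fun x hx => lt_maximalFunction_iff.1 hx
  choose! r hr0 hr using hex
  set I : ℝ := ((∫⁻ y, g y ∂μ) / t).toReal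
  have hfin : (∫⁻ y, g y ∂μ) / t ≠ ∞ := ENNReal.div_ne_top hg ht
  have hbound : ∀ x ∈ {x | t < maximalFunction μ g x}, r x ≤ max 1 I := by
    intro x hx
    rcases le_total (r x) 1 with h1 | h1
    · exact h1.trans (le_max_left _ _)
    · refine le_trans ?_ (le_max_right _ _)
      have h2 : ENNReal.ofReal (r x ^ finrank ℝ E) ≤ (∫⁻ y, g y ∂μ) / t := by
        rw [ENNReal.le_div_iff_mul_le (Or.inl ht) (Or.inl ht'), mul_comm]
        exact (hr x hx).le.trans (setLIntegral_le_lintegral _ _)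
      exact (le_self_pow₀ h1 hd).trans ((ENNReal.ofReal_le_iff_le_toReal hfin).1 h2)
  obtain ⟨u, hut, hdisj, hcov⟩ := Vitali.exists_disjoint_subfamily_covering_enlargement_closedBall
    {x | t < maximalFunction μ g x} (fun x => x) r _ hbound 5 (by norm_num)
  have hucount : u.Countable := by
    refine hdisj.countable_of_nonempty_interior fun x hx => ?_
    exact ⟨x, ball_subset_interior_closedBall (mem_ball_self (hr0 x (hut hx)))⟩
  calc μ {x | t < maximalFunction μ g x}
      ≤ μ (⋃ b ∈ u, closedBall b (5 * r b)) := by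
        refine measure_mono fun x hx => ?_
        obtain ⟨b, hb, hsub⟩ := hcov x hx
        exact mem_biUnion hb (hsub (mem_closedBall_self (hr0 x hx).le))
    _ ≤ ∑' b : u, μ (closedBall (b : E) (5 * r b)) := measure_biUnion_le μ hucount _
    _ ≤ ∑' b : u, ENNReal.ofReal (5 ^ finrank ℝ E) * μ (ball 0 1) / t *
          ∫⁻ y in ball (b : E) (r b), g y ∂μ := by
        refine ENNReal.tsum_le_tsum fun b => ?_
        have hb := hut b.2
        rw [Measure.addHaar_closedBall μ _ (by linarith [hr0 b hb]), mul_pow,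
          ENNReal.ofReal_mul (by positivity)]
        have h2 : ENNReal.ofReal (r b ^ finrank ℝ E) ≤ (∫⁻ y in ball (b : E) (r b), g y ∂μ) / t := by
          rw [ENNReal.le_div_iff_mul_le (Or.inl ht) (Or.inl ht'), mul_comm]
          exact (hr b hb).le
        calc _ ≤ ENNReal.ofReal (5 ^ finrank ℝ E) * ((∫⁻ y in ball (b : E) (r b), g y ∂μ) / t) *
              μ (ball 0 1) := by gcongr
          _ = _ := by simp only [div_eq_mul_inv]; ring
    _ = ENNReal.ofReal (5 ^ finrank ℝ E) * μ (ball 0 1) / t *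
          ∫⁻ y in ⋃ b ∈ u, ball b (r b), g y ∂μ := by
        rw [ENNReal.tsum_mul_left, lintegral_biUnion hucount (fun b _ => measurableSet_ball)]
        exact hdisj.mono fun b => ball_subset_closedBall
    _ ≤ ENNReal.ofReal (5 ^ finrank ℝ E) * μ (ball 0 1) / t * ∫⁻ y, g y ∂μ := by
        exact mul_le_mul_right (setLIntegral_le_lintegral _ _) _
    _ = _ := by simp only [div_eq_mul_inv]; ring

/-- The maximal theorem: the maximal function is bounded on `L^p` for `p > 1`. At height `t` the
weak type bound is applied to the part of `g` exceeding `l * t`, and the layer cake formula is used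
on both sides. -/
theorem lintegral_maximalFunction_rpow_le {p : ℝ} (hp : 1 < p) :
    ∃ C : ℝ≥0∞, C ≠ ∞ ∧ ∀ g : E → ℝ≥0∞, Measurable g →
      ∫⁻ x, maximalFunction μ g x ^ p ∂μ ≤ C * ∫⁻ x, g x ^ p ∂μ := by
  set B : ℝ≥0∞ := μ (ball (0 : E) 1) with hB
  have hB0 : B ≠ 0 := (measure_ball_pos μ 0 one_pos).ne'
  have hBt : B ≠ ∞ := measure_ball_lt_top.ne
  set K : ℝ≥0∞ := ENNReal.ofReal (5 ^ finrank ℝ E) * B with hK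
  have hKt : K ≠ ∞ := ENNReal.mul_ne_top ENNReal.ofReal_ne_top hBt
  -- `l` is chosen so that the part of `g` below `l * t` contributes at most `t / 2`
  set l : ℝ≥0∞ := 2⁻¹ / B with hl
  have hl0 : l ≠ 0 := (ENNReal.div_pos (by simp) hBt).ne'
  have hlt : l ≠ ∞ := ENNReal.div_ne_top (by simp) hB0
  have hp0 : 0 < p := by linarith
  have hp1 : 0 < p - 1 := by linarith
  refine ⟨ENNReal.ofReal p * (2 * K * (l⁻¹ ^ (p - 1) / ENNReal.ofReal (p - 1))), ?_, ?_⟩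
  · refine ENNReal.mul_ne_top ENNReal.ofReal_ne_top (ENNReal.mul_ne_top
      (ENNReal.mul_ne_top (by simp) hKt) (ENNReal.div_ne_top ?_ (by simpa using hp)))
    exact ENNReal.rpow_ne_top_of_nonneg hp1.le (ENNReal.inv_ne_top.2 hl0)
  intro g hg
  -- the weak type bound for the part of `g` above the height `l * t`
  have hsplit : ∀ t : ℝ, 0 < t → μ {x | ENNReal.ofReal t < maximalFunction μ g x} ≤
      2 * K / ENNReal.ofReal t *
        ∫⁻ y, (if ENNReal.ofReal t < g y / l then g y else 0) ∂μ := by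
    intro t ht
    have ht0 : ENNReal.ofReal t ≠ 0 := by simpa using ht
    have hsub : {x | ENNReal.ofReal t < maximalFunction μ g x} ⊆
        {x | ENNReal.ofReal t / 2 < maximalFunction μ
          (fun y => if ENNReal.ofReal t < g y / l then g y else 0) x} := by
      intro x hx
      obtain ⟨ρ, hρ, h⟩ := lt_maximalFunction_iff.1 hx
      refine lt_maximalFunction_iff.2 ⟨ρ, hρ, ?_⟩
      set V := ENNReal.ofReal (ρ ^ finrank ℝ E)
      have hle : ∫⁻ y in ball x ρ, g y ∂μ ≤
          (∫⁻ y in ball x ρ, (if ENNReal.ofReal t < g y / l then g y else 0) ∂μ) +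
            ENNReal.ofReal t / 2 * V := by
        calc ∫⁻ y in ball x ρ, g y ∂μ
            ≤ ∫⁻ y in ball x ρ, ((if ENNReal.ofReal t < g y / l then g y else 0) +
              ENNReal.ofReal t * l) ∂μ := by
              refine lintegral_mono fun y => ?_
              dsimp only
              split_ifs with hy
              · exact le_self_add
              · rw [zero_add, ← ENNReal.div_le_iff hl0 hlt]
                exact not_lt.1 hy
          _ = _ := by
              rw [lintegral_add_right _ measurable_const, setLIntegral_const,
                Measure.addHaar_ball μ x hρ.le, ← hB, hl]
              congr 1
              calc _ = ENNReal.ofReal t * 2⁻¹ * V * (B * B⁻¹) := by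
                    simp only [div_eq_mul_inv]; ring
                _ = _ := by rw [ENNReal.mul_inv_cancel hB0 hBt, mul_one, div_eq_mul_inv]
      have h2 : ENNReal.ofReal t / 2 * V + ENNReal.ofReal t / 2 * V = ENNReal.ofReal t * V := by
        rw [← add_mul, ENNReal.add_halves]
      have h3 := h.trans_le hle
      rw [← h2] at h3
      exact lt_of_add_lt_add_right h3
    refine (measure_mono hsub).trans ((measure_lt_maximalFunction_le _
      (ENNReal.div_pos ht0 (by simp)).ne' (ENNReal.div_ne_top ENNReal.ofReal_ne_top (by simp))).trans
      (le_of_eq ?_))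
    rw [← hK]
    simp only [div_eq_mul_inv]
    rw [ENNReal.mul_inv (Or.inr (by simp)) (Or.inr (by simp)), inv_inv]
    ring
  have hm : Measurable (maximalFunction μ g) := measurable_maximalFunction
  calc ∫⁻ x, maximalFunction μ g x ^ p ∂μ
      = ∫⁻ x, (ENNReal.ofReal p * ∫⁻ t in Ioi (0 : ℝ),
          (if ENNReal.ofReal t < maximalFunction μ g x then ENNReal.ofReal (t ^ (p - 1)) else 0))
          ∂μ := by
        refine lintegral_congr fun x => ?_
        rw [lintegral_Ioi_indicator_rpow_sub_one hp0, ENNReal.mul_div_cancel (by simpa using hp0)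
          ENNReal.ofReal_ne_top]
    _ = ENNReal.ofReal p * ∫⁻ t in Ioi (0 : ℝ), ∫⁻ x,
          (if ENNReal.ofReal t < maximalFunction μ g x then ENNReal.ofReal (t ^ (p - 1)) else 0)
          ∂μ := by
        rw [lintegral_const_mul' _ _ ENNReal.ofReal_ne_top, lintegral_lintegral_swap]
        refine (Measurable.ite (measurableSet_lt (by fun_prop) (by fun_prop)) (by fun_prop)
          measurable_const).aemeasurable
    _ ≤ ENNReal.ofReal p * ∫⁻ t in Ioi (0 : ℝ), ∫⁻ y, 2 * K *
          (g y * (if ENNReal.ofReal t < g y / l then ENNReal.ofReal (t ^ (p - 1 - 1)) else 0)) ∂μ := by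
        gcongr ENNReal.ofReal p * ?_
        refine setLIntegral_mono' measurableSet_Ioi fun t ht => ?_
        have ht' : (0 : ℝ) < t := ht
        have ht0 : ENNReal.ofReal t ≠ 0 := by simpa using ht
        have e1 : ∫⁻ x, (if ENNReal.ofReal t < maximalFunction μ g x then
            ENNReal.ofReal (t ^ (p - 1)) else 0) ∂μ =
            ENNReal.ofReal (t ^ (p - 1)) * μ {x | ENNReal.ofReal t < maximalFunction μ g x} := by
          rw [← setLIntegral_const, ← lintegral_indicator (measurableSet_lt measurable_const hm)]
          simp only [indicator, mem_ofPred_eq]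
        have e2 : ENNReal.ofReal (t ^ (p - 1)) / ENNReal.ofReal t =
            ENNReal.ofReal (t ^ (p - 1 - 1)) := by
          rw [Real.rpow_sub_one ht'.ne' (p - 1), ENNReal.ofReal_div_of_pos ht']
        rw [e1]
        calc _ ≤ ENNReal.ofReal (t ^ (p - 1)) * (2 * K / ENNReal.ofReal t *
              ∫⁻ y, (if ENNReal.ofReal t < g y / l then g y else 0) ∂μ) := by
              gcongr
              exact hsplit t ht
          _ = 2 * K * (ENNReal.ofReal (t ^ (p - 1)) / ENNReal.ofReal t) *
              ∫⁻ y, (if ENNReal.ofReal t < g y / l then g y else 0) ∂μ := by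
              simp only [div_eq_mul_inv]; ring
          _ = _ := by
              rw [e2, ← lintegral_const_mul]
              · refine lintegral_congr fun y => ?_
                split_ifs
                · ring
                · simp
              · exact Measurable.ite (measurableSet_lt measurable_const (by fun_prop)) hg
                  measurable_const
    _ = ENNReal.ofReal p * ∫⁻ y, (2 * K * (g y * ∫⁻ t in Ioi (0 : ℝ),
          (if ENNReal.ofReal t < g y / l then ENNReal.ofReal (t ^ (p - 1 - 1)) else 0))) ∂μ := by
        have hmt : Measurable (fun z : ℝ × E => if ENNReal.ofReal z.1 < g z.2 / l then
            ENNReal.ofReal (z.1 ^ (p - 1 - 1)) else 0) :=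
          Measurable.ite (measurableSet_lt (by fun_prop) (by fun_prop)) (by fun_prop)
            measurable_const
        rw [lintegral_lintegral_swap]
        · congr 1
          refine lintegral_congr fun y => ?_
          have := hmt.comp (measurable_prodMk_right (y := y))
          simp only [Function.comp_def] at this
          rw [lintegral_const_mul _ (this.const_mul _), lintegral_const_mul _ this]
        · exact (((hg.comp measurable_snd).mul hmt).const_mul _).aemeasurable
    _ = ENNReal.ofReal p * ∫⁻ y, 2 * K * (l⁻¹ ^ (p - 1) / ENNReal.ofReal (p - 1)) * g y ^ p ∂μ := by
        congr 1
        refine lintegral_congr fun y => ?_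
        rw [lintegral_Ioi_indicator_rpow_sub_one hp1]
        have e3 : g y ^ p = g y * g y ^ (p - 1) := by
          conv_rhs => rw [← ENNReal.rpow_one (g y), ← ENNReal.rpow_mul, one_mul,
            ← ENNReal.rpow_add_of_nonneg _ _ zero_le_one hp1.le, add_sub_cancel]
        rw [div_eq_mul_inv (g y), ENNReal.mul_rpow_of_nonneg _ _ hp1.le, e3]
        simp only [div_eq_mul_inv]; ring
    _ = _ := by
        rw [lintegral_const_mul _ (by fun_prop), ← mul_assoc]

end Maximal

/-! ### Superpositions of heat kernels on `L^p` -/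

section Potential
open Set Metric Module

/-- Hedberg's optimization: a bound that is better for small `b` and a decaying bound that is
better for large `b` combine to a geometric mean of the two constants. -/
theorem lintegral_Ioi_rpow_mul_le {P : ℝ → ℝ≥0∞} {A F : ℝ≥0∞} {σ ν : ℝ} (hσ : 0 < σ) (hσν : σ < ν)
    (hF : F ≠ ∞) (hPA : ∀ b, 0 < b → P b ≤ A)
    (hPF : ∀ b, 0 < b → P b ≤ F * ENNReal.ofReal (b ^ (-ν))) :
    ∫⁻ b in Ioi (0 : ℝ), ENNReal.ofReal (b ^ (σ - 1)) * P b ≤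
      ENNReal.ofReal (1 / σ + 1 / (ν - σ)) * (A ^ (1 - σ / ν) * F ^ (σ / ν)) := by
  have hν : 0 < ν := hσ.trans hσν
  have hθ : 0 < 1 - σ / ν := sub_pos.2 ((div_lt_one hν).2 hσν)
  have hpos : 0 < 1 / σ + 1 / (ν - σ) := by
    have := sub_pos.2 hσν
    positivity
  have hzero : (∀ b, 0 < b → P b = 0) → ∫⁻ b in Ioi (0 : ℝ), ENNReal.ofReal (b ^ (σ - 1)) * P b ≤
      ENNReal.ofReal (1 / σ + 1 / (ν - σ)) * (A ^ (1 - σ / ν) * F ^ (σ / ν)) := by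
    intro h
    rw [setLIntegral_congr_fun measurableSet_Ioi (g := fun _ => 0) fun b hb => by simp [h b hb]]
    simp
  by_cases hF0 : F = 0
  · exact hzero fun b hb => by simpa [hF0] using hPF b hb
  by_cases hA0 : A = 0
  · exact hzero fun b hb => by simpa [hA0] using hPA b hb
  by_cases hAt : A = ∞
  · rw [hAt, ENNReal.top_rpow_of_pos hθ, ENNReal.top_mul, ENNReal.mul_top]
    · exact le_top
    · simpa using hpos
    · exact (ENNReal.rpow_pos (pos_iff_ne_zero.2 hF0) hF).ne'
  -- the two bounds for `P` balance at `T`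
  obtain ⟨m, hm, rfl⟩ : ∃ m : ℝ, 0 < m ∧ A = ENNReal.ofReal m :=
    ⟨A.toReal, ENNReal.toReal_pos hA0 hAt, (ENNReal.ofReal_toReal hAt).symm⟩
  obtain ⟨f, hf, rfl⟩ : ∃ f : ℝ, 0 < f ∧ F = ENNReal.ofReal f :=
    ⟨F.toReal, ENNReal.toReal_pos hF0 hF, (ENNReal.ofReal_toReal hF).symm⟩
  set T : ℝ := (f / m) ^ (1 / ν)
  have hT : 0 < T := by positivity
  have hlow : ∫⁻ b in Ioc 0 T, ENNReal.ofReal (b ^ (σ - 1)) * P b ≤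
      ENNReal.ofReal (T ^ σ / σ) * ENNReal.ofReal m := by
    rw [← lintegral_Ioo_rpow_sub_one hσ hT.le, setLIntegral_congr Ioo_ae_eq_Ioc,
      ← lintegral_mul_const _ (by fun_prop)]
    exact setLIntegral_mono' measurableSet_Ioc fun b hb => by gcongr; exact hPA b hb.1
  have hhigh : ∫⁻ b in Ioi T, ENNReal.ofReal (b ^ (σ - 1)) * P b ≤
      ENNReal.ofReal f * ENNReal.ofReal (T ^ (-(ν - σ)) / (ν - σ)) := by
    rw [← lintegral_Ioi_rpow_neg_sub_one (sub_pos.2 hσν) hT, ← lintegral_const_mul _ (by fun_prop)]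
    refine setLIntegral_mono' measurableSet_Ioi fun b hb => ?_
    have hb0 : 0 < b := hT.trans hb
    calc _ ≤ ENNReal.ofReal (b ^ (σ - 1)) * (ENNReal.ofReal f * ENNReal.ofReal (b ^ (-ν))) := by
          gcongr; exact hPF b hb0
      _ = ENNReal.ofReal f * (ENNReal.ofReal (b ^ (σ - 1)) * ENNReal.ofReal (b ^ (-ν))) := by ring
      _ = _ := by
          rw [← ENNReal.ofReal_mul (by positivity), ← Real.rpow_add hb0]
          congr 3; ring
  have hT1 : T ^ σ * m = m ^ (1 - σ / ν) * f ^ (σ / ν) := by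
    rw [← Real.rpow_mul (by positivity), Real.div_rpow hf.le hm.le, Real.rpow_sub hm, Real.rpow_one,
      one_div_mul_eq_div]
    ring
  have hT2 : f * T ^ (-(ν - σ)) = m ^ (1 - σ / ν) * f ^ (σ / ν) := by
    have : 1 / ν * -(ν - σ) = -(1 - σ / ν) := by field_simp
    rw [← Real.rpow_mul (by positivity), this, Real.rpow_neg (by positivity),
      Real.div_rpow hf.le hm.le, Real.rpow_sub hf, Real.rpow_one]
    field_simp
  calc ∫⁻ b in Ioi (0 : ℝ), ENNReal.ofReal (b ^ (σ - 1)) * P b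
      ≤ ENNReal.ofReal (T ^ σ / σ) * ENNReal.ofReal m +
        ENNReal.ofReal f * ENNReal.ofReal (T ^ (-(ν - σ)) / (ν - σ)) := by
        rw [← Ioc_union_Ioi_eq_Ioi hT.le]
        exact (lintegral_union_le _ _ _).trans (add_le_add hlow hhigh)
    _ = _ := by
        have hνσ := sub_pos.2 hσν
        rw [ENNReal.ofReal_rpow_of_pos hm, ENNReal.ofReal_rpow_of_pos hf,
          ← ENNReal.ofReal_mul (by positivity), ← ENNReal.ofReal_mul (by positivity),
          ← ENNReal.ofReal_mul (by positivity), ← ENNReal.ofReal_mul (by positivity),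
          ← ENNReal.ofReal_add (by positivity) (by positivity), ← hT1]
        congr 1
        rw [add_mul, mul_div_assoc', hT2, ← hT1]
        ring

theorem lintegral_Ioi_gaussian_weight {κ d : ℝ} (hκ : 0 < κ) (hd : 0 ≤ d) :
    ∫⁻ ρ in Ioi d, ENNReal.ofReal (2 * κ * ρ * Real.exp (-κ * ρ ^ 2)) =
      ENNReal.ofReal (Real.exp (-κ * d ^ 2)) := by
  have hderiv : ∀ x ∈ Ici d, HasDerivAt (fun ρ : ℝ => -Real.exp (-κ * ρ ^ 2))
      (2 * κ * x * Real.exp (-κ * x ^ 2)) x := by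
    intro x _
    have h1 : HasDerivAt (fun ρ : ℝ => -κ * ρ ^ 2) (-κ * (2 * x)) x := by
      simpa using (hasDerivAt_pow 2 x).const_mul (-κ)
    convert! h1.exp.neg using 1
    ring
  have hnn : ∀ x ∈ Ioi d, 0 ≤ 2 * κ * x * Real.exp (-κ * x ^ 2) := fun x hx => by
    have : 0 ≤ x := hd.trans (le_of_lt hx)
    positivity
  have hlim : Filter.Tendsto (fun ρ : ℝ => -Real.exp (-κ * ρ ^ 2)) Filter.atTop (nhds 0) := by
    rw [← neg_zero]
    refine (Real.tendsto_exp_atBot.comp ?_).neg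
    exact (Filter.tendsto_pow_atTop two_ne_zero).const_mul_atTop_of_neg (by linarith)
  rw [← ofReal_integral_eq_lintegral_ofReal, integral_Ioi_of_hasDerivAt_of_nonneg' hderiv hnn hlim]
  · simp
  · exact integrableOn_Ioi_deriv_of_nonneg' hderiv hnn hlim
  · filter_upwards [ae_restrict_mem measurableSet_Ioi] with x hx using hnn x hx

theorem lintegral_Ioi_gaussian_weight_mul_rpow {κ a : ℝ} (hκ : 0 < κ) (ha : 0 ≤ a) :
    ∫⁻ ρ in Ioi (0 : ℝ), ENNReal.ofReal (2 * κ * ρ * Real.exp (-κ * ρ ^ 2)) *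
      ENNReal.ofReal (ρ ^ a) = ENNReal.ofReal (κ ^ (-a / 2) * Real.Gamma (a / 2 + 1)) := by
  have hint := integrableOn_rpow_mul_exp_neg_mul_rpow (s := a + 1) (p := 2) (by linarith)
    (by norm_num) hκ
  have heq : ∀ ρ ∈ Ioi (0 : ℝ), ENNReal.ofReal (2 * κ * ρ * Real.exp (-κ * ρ ^ 2)) *
      ENNReal.ofReal (ρ ^ a) =
      ENNReal.ofReal (2 * κ * (ρ ^ (a + 1) * Real.exp (-κ * ρ ^ (2 : ℝ)))) := by
    intro ρ hρ
    have hρ' : (0 : ℝ) < ρ := hρ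
    rw [← ENNReal.ofReal_mul (by positivity), Real.rpow_add_one hρ'.ne', Real.rpow_two]
    congr 1
    ring
  rw [setLIntegral_congr_fun measurableSet_Ioi heq, ← ofReal_integral_eq_lintegral_ofReal,
    integral_const_mul, integral_rpow_mul_exp_neg_mul_rpow (by norm_num) (by linarith) hκ]
  · congr 1
    have e1 : -(a + 1 + 1) / 2 = -a / 2 - 1 := by ring
    have e2 : (a + 1 + 1) / 2 = a / 2 + 1 := by ring
    rw [e1, e2, Real.rpow_sub_one hκ.ne']
    field_simp
  · exact hint.const_mul _
  · filter_upwards [ae_restrict_mem measurableSet_Ioi] with ρ hρ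
    have hρ' : (0 : ℝ) < ρ := hρ
    positivity

variable {E : Type*} [NormedAddCommGroup E] [MeasurableSpace E] [BorelSpace E]

/-- A growth bound `D ρ ^ a` for the integrals of `g` over balls bounds its Gaussian averages: a
Gaussian is a superposition of indicators of balls. -/
theorem lintegral_gaussian_mul_le {μ : Measure E} [SFinite μ] [SecondCountableTopology E]
    {g : E → ℝ≥0∞} (hg : Measurable g) (x : E)
    {κ a : ℝ} (hκ : 0 < κ) (ha : 0 ≤ a) {D : ℝ≥0∞}
    (hD : ∀ ρ, 0 < ρ → ∫⁻ y in ball x ρ, g y ∂μ ≤ D * ENNReal.ofReal (ρ ^ a)) :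
    ∫⁻ y, ENNReal.ofReal (Real.exp (-κ * ‖x - y‖ ^ 2)) * g y ∂μ ≤
      D * ENNReal.ofReal (κ ^ (-a / 2) * Real.Gamma (a / 2 + 1)) := by
  set w : ℝ → ℝ≥0∞ := fun ρ => ENNReal.ofReal (2 * κ * ρ * Real.exp (-κ * ρ ^ 2)) with hw
  have hwm : Measurable w := by fun_prop
  have hm : Measurable (fun z : E × ℝ => if ‖x - z.1‖ < z.2 then w z.2 * g z.1 else 0) :=
    Measurable.ite (measurableSet_lt (by fun_prop) (by fun_prop)) (by fun_prop) measurable_const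
  calc ∫⁻ y, ENNReal.ofReal (Real.exp (-κ * ‖x - y‖ ^ 2)) * g y ∂μ
      = ∫⁻ y, (∫⁻ ρ in Ioi (0 : ℝ), if ‖x - y‖ < ρ then w ρ * g y else 0) ∂μ := by
        refine lintegral_congr fun y => ?_
        rw [← lintegral_Ioi_gaussian_weight hκ (norm_nonneg (x - y)),
          ← lintegral_mul_const _ hwm, ← inter_eq_left.2 (Ioi_subset_Ioi (norm_nonneg (x - y))),
          ← setLIntegral_indicator measurableSet_Ioi]
        rfl
    _ = ∫⁻ ρ in Ioi (0 : ℝ), w ρ * ∫⁻ y in ball x ρ, g y ∂μ := by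
        rw [lintegral_lintegral_swap hm.aemeasurable]
        refine lintegral_congr fun ρ => ?_
        rw [← lintegral_const_mul _ hg, ← lintegral_indicator measurableSet_ball]
        refine lintegral_congr fun y => ?_
        simp [indicator, mem_ball, dist_comm y x, dist_eq_norm]
    _ ≤ ∫⁻ ρ in Ioi (0 : ℝ), D * (w ρ * ENNReal.ofReal (ρ ^ a)) := by
        refine setLIntegral_mono' measurableSet_Ioi fun ρ hρ => ?_
        calc w ρ * ∫⁻ y in ball x ρ, g y ∂μ ≤ w ρ * (D * ENNReal.ofReal (ρ ^ a)) := by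
              gcongr; exact hD ρ hρ
          _ = _ := by ring
    _ = _ := by
        rw [lintegral_const_mul _ (by fun_prop), lintegral_Ioi_gaussian_weight_mul_rpow hκ ha]

variable [NormedSpace ℝ E]

/-- The heat kernel in the parametrization in which it is the Fourier transform of
`ξ ↦ exp (-b ‖ξ‖²)`, for the Fourier kernel `exp (-2πi x·ξ)`. -/
noncomputable def gaussianKernel (b : ℝ) (z : E) : ℝ :=
  (Real.pi / b) ^ ((finrank ℝ E : ℝ) / 2) * Real.exp (-(Real.pi ^ 2 / b) * ‖z‖ ^ 2)

theorem measurable_gaussianKernel_sub [SecondCountableTopology E] :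
    Measurable (fun z : ℝ × E × E => gaussianKernel z.1 (z.2.1 - z.2.2)) := by
  unfold gaussianKernel
  fun_prop

/-- The superposition `∫₀^∞ b ^ (s / 2 - 1) (G_b * g) db` of the heat kernels `G_b`. Up to a constant
it is the Riesz potential of order `s` of `g`. -/
noncomputable def heatPotential (μ : Measure E) (s : ℝ) (g : E → ℝ≥0∞) (x : E) : ℝ≥0∞ :=
  ∫⁻ b in Ioi (0 : ℝ), ENNReal.ofReal (b ^ (s / 2 - 1)) *
    ∫⁻ y, ENNReal.ofReal (gaussianKernel b (x - y)) * g y ∂μ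

variable [FiniteDimensional ℝ E]

theorem measurable_gaussianKernel_sub_mul {g : E → ℝ≥0∞} (hg : Measurable g) :
    Measurable fun z : (ℝ × E) × E =>
      ENNReal.ofReal (gaussianKernel z.1.1 (z.1.2 - z.2)) * g z.2 := by
  refine Measurable.mul ?_ (hg.comp measurable_snd)
  exact (measurable_gaussianKernel_sub.comp
    ((measurable_fst.comp measurable_fst).prodMk
      ((measurable_snd.comp measurable_fst).prodMk measurable_snd))).ennreal_ofReal

theorem measurable_rpow_mul_lintegral_gaussianKernel {μ : Measure E} [SFinite μ] (s : ℝ)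
    {g : E → ℝ≥0∞} (hg : Measurable g) :
    Measurable fun z : ℝ × E => ENNReal.ofReal (z.1 ^ (s / 2 - 1)) *
      ∫⁻ y, ENNReal.ofReal (gaussianKernel z.1 (z.2 - y)) * g y ∂μ :=
  Measurable.mul (by fun_prop) (measurable_gaussianKernel_sub_mul hg).lintegral_prod_right'

theorem measurable_heatPotential {μ : Measure E} [SFinite μ] (s : ℝ) {g : E → ℝ≥0∞}
    (hg : Measurable g) : Measurable (heatPotential μ s g) :=
  (measurable_rpow_mul_lintegral_gaussianKernel s hg).lintegral_prod_left'

/-- Tonelli's theorem moves the heat kernels from `g` to `h`. -/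
theorem lintegral_heatPotential_mul {μ : Measure E} [SFinite μ] (s : ℝ) {g h : E → ℝ≥0∞}
    (hg : Measurable g) (hh : Measurable h) :
    ∫⁻ x, heatPotential μ s g x * h x ∂μ =
      ∫⁻ b in Ioi (0 : ℝ), ENNReal.ofReal (b ^ (s / 2 - 1)) *
        ∫⁻ y, g y * ∫⁻ x, ENNReal.ofReal (gaussianKernel b (x - y)) * h x ∂μ ∂μ := by
  have hm := measurable_rpow_mul_lintegral_gaussianKernel (μ := μ) s hg
  calc ∫⁻ x, heatPotential μ s g x * h x ∂μ
      = ∫⁻ x, (∫⁻ b in Ioi (0 : ℝ), ENNReal.ofReal (b ^ (s / 2 - 1)) *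
          (∫⁻ y, ENNReal.ofReal (gaussianKernel b (x - y)) * g y ∂μ) * h x) ∂μ := by
        refine lintegral_congr fun x => ?_
        exact (lintegral_mul_const _ (hm.comp measurable_prodMk_right)).symm
    _ = ∫⁻ b in Ioi (0 : ℝ), ∫⁻ x, ENNReal.ofReal (b ^ (s / 2 - 1)) *
          (∫⁻ y, ENNReal.ofReal (gaussianKernel b (x - y)) * g y ∂μ) * h x ∂μ :=
        lintegral_lintegral_swap
          ((hm.comp measurable_swap).mul (hh.comp measurable_fst)).aemeasurable
    _ = _ := by
        refine lintegral_congr fun b => ?_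
        have hb : Measurable fun z : E × E =>
            ENNReal.ofReal (gaussianKernel b (z.1 - z.2)) * g z.2 * h z.1 :=
          ((measurable_gaussianKernel_sub_mul hg).comp
            ((measurable_const.prodMk measurable_fst).prodMk measurable_snd)).mul
            (hh.comp measurable_fst)
        have hx : ∀ x, (∫⁻ y, ENNReal.ofReal (gaussianKernel b (x - y)) * g y ∂μ) * h x =
            ∫⁻ y, ENNReal.ofReal (gaussianKernel b (x - y)) * g y * h x ∂μ := fun x =>
          (lintegral_mul_const _ ((measurable_gaussianKernel_sub_mul hg).comp
            (measurable_prodMk_left (x := (b, x))))).symm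
        have hy : ∀ y, g y * ∫⁻ x, ENNReal.ofReal (gaussianKernel b (x - y)) * h x ∂μ =
            ∫⁻ x, ENNReal.ofReal (gaussianKernel b (x - y)) * g y * h x ∂μ := fun y => by
          have hKy : Measurable fun x : E => ENNReal.ofReal (gaussianKernel b (x - y)) :=
            (measurable_gaussianKernel_sub.comp (measurable_const.prodMk
              (measurable_id.prodMk measurable_const))).ennreal_ofReal
          refine (lintegral_const_mul _ (hKy.mul hh)).symm.trans (lintegral_congr fun x => ?_)
          simp only [Pi.mul_apply]
          ring
        simp only [mul_assoc, lintegral_const_mul' _ _ ENNReal.ofReal_ne_top]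
        simp only [hx, hy]
        rw [lintegral_lintegral_swap hb.aemeasurable]

theorem lintegral_gaussianKernel_mul_le {μ : Measure E} [SFinite μ]
    {g : E → ℝ≥0∞} (hg : Measurable g) (x : E) {b a : ℝ} (hb : 0 < b) (ha : 0 ≤ a) {D : ℝ≥0∞}
    (hD : ∀ ρ, 0 < ρ → ∫⁻ y in ball x ρ, g y ∂μ ≤ D * ENNReal.ofReal (ρ ^ a)) :
    ∫⁻ y, ENNReal.ofReal (gaussianKernel b (x - y)) * g y ∂μ ≤
      D * ENNReal.ofReal (Real.pi ^ ((finrank ℝ E : ℝ) / 2 - a) * Real.Gamma (a / 2 + 1)) *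
        ENNReal.ofReal (b ^ ((a - finrank ℝ E) / 2)) := by
  have hπ := Real.pi_pos
  have hΓ : 0 < Real.Gamma (a / 2 + 1) := Real.Gamma_pos_of_pos (by linarith)
  have hκ : 0 < Real.pi ^ 2 / b := by positivity
  calc ∫⁻ y, ENNReal.ofReal (gaussianKernel b (x - y)) * g y ∂μ
      = ENNReal.ofReal ((Real.pi / b) ^ ((finrank ℝ E : ℝ) / 2)) *
        ∫⁻ y, ENNReal.ofReal (Real.exp (-(Real.pi ^ 2 / b) * ‖x - y‖ ^ 2)) * g y ∂μ := by
        rw [← lintegral_const_mul' _ _ ENNReal.ofReal_ne_top]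
        refine lintegral_congr fun y => ?_
        rw [gaussianKernel, ENNReal.ofReal_mul (by positivity), mul_assoc]
    _ ≤ ENNReal.ofReal ((Real.pi / b) ^ ((finrank ℝ E : ℝ) / 2)) *
        (D * ENNReal.ofReal ((Real.pi ^ 2 / b) ^ (-a / 2) * Real.Gamma (a / 2 + 1))) := by
        gcongr
        exact lintegral_gaussian_mul_le hg x hκ ha hD
    _ = _ := by
        rw [mul_left_comm, mul_assoc, ← ENNReal.ofReal_mul (by positivity),
          ← ENNReal.ofReal_mul (by positivity)]
        congr 2
        have e1 : (Real.pi ^ 2) ^ (-a / 2) = Real.pi ^ (-a) := by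
          rw [← Real.rpow_natCast, ← Real.rpow_mul hπ.le]
          congr 1; push_cast; ring
        have e2 : (a - finrank ℝ E) / 2 = -((finrank ℝ E : ℝ) / 2) - -a / 2 := by ring
        have e3 : (finrank ℝ E : ℝ) / 2 - a = (finrank ℝ E : ℝ) / 2 + -a := by ring
        rw [Real.div_rpow hπ.le hb.le, Real.div_rpow (by positivity) hb.le, e1, e2, e3,
          Real.rpow_sub hb, Real.rpow_add hπ, Real.rpow_neg hb.le]
        field_simp

/-- Hölder's inequality on a ball. -/
theorem setLIntegral_ball_le_rpow {μ : Measure E} [μ.IsAddHaarMeasure]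
    {g : E → ℝ≥0∞} (hg : Measurable g) {p : ℝ} (hp : 1 < p) (x : E) {ρ : ℝ} (hρ : 0 < ρ) :
    ∫⁻ y in ball x ρ, g y ∂μ ≤ (∫⁻ y, g y ^ p ∂μ) ^ (1 / p) * μ (ball 0 1) ^ (1 - 1 / p) *
      ENNReal.ofReal (ρ ^ ((finrank ℝ E : ℝ) - finrank ℝ E / p)) := by
  have hpq := Real.HolderConjugate.conjExponent hp
  have hq : 1 / p.conjExponent = 1 - 1 / p := by
    have := hpq.inv_add_inv_eq_one
    rw [one_div, one_div]; linarith
  have hq0 : 0 ≤ 1 - 1 / p := by rw [← hq]; exact one_div_nonneg.2 hpq.symm.nonneg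
  have h := ENNReal.lintegral_mul_le_Lp_mul_Lq (μ.restrict (ball x ρ)) hpq hg.aemeasurable
    (g := fun _ => 1) aemeasurable_const
  simp only [Pi.mul_apply, mul_one, ENNReal.one_rpow, lintegral_one, Measure.restrict_apply_univ,
    hq] at h
  refine h.trans ?_
  rw [Measure.addHaar_ball_of_pos μ x hρ, ENNReal.mul_rpow_of_nonneg _ _ hq0,
    ENNReal.ofReal_rpow_of_pos (by positivity), ← Real.rpow_natCast, ← Real.rpow_mul hρ.le,
    mul_assoc, mul_comm (μ _ ^ _)]
  have e : (finrank ℝ E : ℝ) * (1 - 1 / p) = (finrank ℝ E : ℝ) - finrank ℝ E / p := by ring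
  rw [e]
  gcongr
  exact Measure.restrict_le_self

/-- The Hardy–Littlewood–Sobolev inequality. By `lintegral_Ioi_rpow_mul_le` the potential is at most
a constant times `(M g) ^ (1 - s p / d) * ‖g‖_p ^ (s p / d)`, with `d` the dimension, and the power
`r` turns the first factor into `(M g) ^ p`. -/
theorem lintegral_heatPotential_rpow_le [Nontrivial E] {μ : Measure E} [μ.IsAddHaarMeasure]
    {s p r : ℝ} (hs : 0 < s) (hp : 1 < p) (hr : 0 < r)
    (hrp : 1 / r = 1 / p - s / finrank ℝ E) :
    ∃ C : ℝ≥0∞, C ≠ ∞ ∧ ∀ g : E → ℝ≥0∞, Measurable g → ∫⁻ y, g y ^ p ∂μ ≠ ∞ →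
      ∫⁻ x, heatPotential μ s g x ^ r ∂μ ≤ C * (∫⁻ y, g y ^ p ∂μ) ^ (r / p) := by
  obtain ⟨C₀, hC₀, hmax⟩ := lintegral_maximalFunction_rpow_le (μ := μ) hp
  set d : ℝ := (finrank ℝ E : ℝ) with hd
  have hd0 : 0 < d := by simpa [hd] using finrank_pos (R := ℝ) (M := E)
  have hp0 : 0 < p := by linarith
  have hπ := Real.pi_pos
  have hspd : s * p < d := by
    have h1 : 0 < 1 / p - s / d := hrp ▸ one_div_pos.2 hr
    have h2 : (1 / p - s / d) * (p * d) = d - s * p := by field_simp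
    nlinarith [mul_pos h1 (mul_pos hp0 hd0)]
  have ha : 0 ≤ d - d / p := by
    have : d / p ≤ d := div_le_self hd0.le hp.le
    linarith
  have hσν : s / 2 < d / (2 * p) := by
    rw [div_lt_div_iff₀ (by norm_num) (by positivity)]
    linarith
  have hratio : s / 2 / (d / (2 * p)) = s * p / d := by field_simp
  have hrpd : r - p = s * p / d * r := by
    have : p * r * (1 / r) = p * r * (1 / p - s / d) := by rw [hrp]
    field_simp at this ⊢
    linarith
  have hrp0 : 0 ≤ r - p := by rw [hrpd]; positivity
  set B : ℝ≥0∞ := μ (ball (0 : E) 1) with hB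
  have hBt : B ≠ ∞ := measure_ball_lt_top.ne
  set c₁ : ℝ≥0∞ := ENNReal.ofReal (Real.pi ^ (d / 2 - d) * Real.Gamma (d / 2 + 1))
  set c₂ : ℝ≥0∞ := ENNReal.ofReal
    (Real.pi ^ (d / 2 - (d - d / p)) * Real.Gamma ((d - d / p) / 2 + 1))
  set c₃ : ℝ≥0∞ := ENNReal.ofReal (1 / (s / 2) + 1 / (d / (2 * p) - s / 2))
  have hBp : B ^ (1 - 1 / p) ≠ ∞ :=
    ENNReal.rpow_ne_top_of_nonneg (sub_nonneg.2 ((div_le_one hp0).2 hp.le)) hBt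
  refine ⟨c₃ ^ r * (c₁ ^ p * (B ^ (1 - 1 / p) * c₂) ^ (r - p)) * C₀, ?_, ?_⟩
  · refine ENNReal.mul_ne_top (ENNReal.mul_ne_top ?_ (ENNReal.mul_ne_top ?_ ?_)) hC₀
    · exact ENNReal.rpow_ne_top_of_nonneg hr.le ENNReal.ofReal_ne_top
    · exact ENNReal.rpow_ne_top_of_nonneg hp0.le ENNReal.ofReal_ne_top
    · exact ENNReal.rpow_ne_top_of_nonneg hrp0 (ENNReal.mul_ne_top hBp ENNReal.ofReal_ne_top)
  intro g hg hgp
  set I : ℝ≥0∞ := ∫⁻ y, g y ^ p ∂μ with hI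
  have hF : I ^ (1 / p) * B ^ (1 - 1 / p) * c₂ ≠ ∞ :=
    ENNReal.mul_ne_top (ENNReal.mul_ne_top
      (ENNReal.rpow_ne_top_of_nonneg (by positivity) hgp) hBp) ENNReal.ofReal_ne_top
  have hpt : ∀ x, heatPotential μ s g x ≤ c₃ * ((maximalFunction μ g x * c₁) ^ (1 - s * p / d) *
      (I ^ (1 / p) * B ^ (1 - 1 / p) * c₂) ^ (s * p / d)) := by
    intro x
    rw [← hratio]
    refine lintegral_Ioi_rpow_mul_le (by positivity) hσν hF (fun b hb => ?_) (fun b hb => ?_)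
    · refine (lintegral_gaussianKernel_mul_le hg x hb hd0.le (D := maximalFunction μ g x)
        fun ρ hρ => ?_).trans (le_of_eq ?_)
      · simpa [hd] using setLIntegral_ball_le_maximalFunction (μ := μ) (g := g) x hρ
      · simp [c₁, ← hd]
    · refine (lintegral_gaussianKernel_mul_le hg x hb ha
        (fun ρ hρ => setLIntegral_ball_le_rpow hg hp x hρ)).trans (le_of_eq ?_)
      rw [← hd, ← hB, ← hI]
      congr 3
      field_simp
      ring
  have he1 : (1 - s * p / d) * r = p := by linarith
  calc ∫⁻ x, heatPotential μ s g x ^ r ∂μ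
      ≤ ∫⁻ x, c₃ ^ r * (c₁ ^ p * (I ^ (1 / p) * B ^ (1 - 1 / p) * c₂) ^ (r - p)) *
          maximalFunction μ g x ^ p ∂μ := by
        refine lintegral_mono fun x => (ENNReal.rpow_le_rpow (hpt x) hr.le).trans (le_of_eq ?_)
        rw [ENNReal.mul_rpow_of_nonneg _ _ hr.le, ENNReal.mul_rpow_of_nonneg _ _ hr.le,
          ← ENNReal.rpow_mul, ← ENNReal.rpow_mul, he1, ← hrpd,
          ENNReal.mul_rpow_of_nonneg _ _ hp0.le]
        ring
    _ = c₃ ^ r * (c₁ ^ p * (I ^ (1 / p) * B ^ (1 - 1 / p) * c₂) ^ (r - p)) *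
          ∫⁻ x, maximalFunction μ g x ^ p ∂μ :=
        lintegral_const_mul _ (measurable_maximalFunction.pow_const _)
    _ ≤ c₃ ^ r * (c₁ ^ p * (I ^ (1 / p) * B ^ (1 - 1 / p) * c₂) ^ (r - p)) * (C₀ * I) := by
        gcongr
        exact hmax g hg
    _ = _ := by
        have he2 : I ^ (r / p) = (I ^ (1 / p)) ^ (r - p) * I := by
          conv_rhs => rw [← ENNReal.rpow_mul, ← ENNReal.rpow_one I, ← ENNReal.rpow_mul, one_mul,
            ← ENNReal.rpow_add_of_nonneg _ _ (by positivity) zero_le_one]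
          congr 1
          field_simp
          ring
        rw [he2, mul_assoc (I ^ (1 / p)), ENNReal.mul_rpow_of_nonneg _ _ hrp0]
        ring

end Potential

/-! ### Gaussians as Fourier multipliers -/

section Fourier
open Set Metric Module

variable {E : Type*} [NormedAddCommGroup E] [InnerProductSpace ℝ E]

theorem hasTemperateGrowth_gaussian {b : ℝ} (hb : 0 ≤ b) :
    (fun ξ : E => ((Real.exp (-(b * ‖ξ‖ ^ 2)) : ℝ) : ℂ)).HasTemperateGrowth := by
  have hreal : (fun ξ : E => Real.exp (-(b * ‖ξ‖ ^ 2))).HasTemperateGrowth := by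
    -- `exp (-t)` grows only for negative `t`, while `b * ‖ξ‖ ^ 2` is nonnegative
    have hopen : IsOpen (Ioi (-1 : ℝ)) := isOpen_Ioi
    refine Function.HasTemperateGrowth.comp' (g := fun t : ℝ => Real.exp (-t))
      (f := fun ξ : E => b * ‖ξ‖ ^ 2) (t := Ioi (-1)) ?_ hopen.uniqueDiffOn
      (by fun_prop) ?_ ?_
    · rintro - ⟨ξ, rfl⟩
      have : 0 ≤ b * ‖ξ‖ ^ 2 := by positivity
      exact lt_of_lt_of_le neg_one_lt_zero this
    · refine fun N => ⟨0, Real.exp 1, (Real.exp_pos 1).le, fun n _ t ht => ?_⟩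
      have hc : ContDiffAt ℝ n (fun t : ℝ => Real.exp (-t)) t := by fun_prop
      have ht' : -1 < t := ht
      rw [norm_iteratedFDerivWithin_eq_norm_iteratedDerivWithin,
        iteratedDerivWithin_eq_iteratedDeriv hopen.uniqueDiffOn hc ht]
      have := iteratedDeriv_comp_neg n Real.exp t
      rw [this, iteratedDeriv_eq_iterate, Real.iter_deriv_exp]
      simp only [norm_smul, norm_pow, norm_neg, norm_one, one_pow, one_mul, Real.norm_eq_abs,
        Real.abs_exp, pow_zero, mul_one]
      exact Real.exp_le_exp.2 (by linarith)
    · exact (Function.HasTemperateGrowth.const b).mul (by fun_prop)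
  exact Function.Complex.hasTemperateGrowth_ofReal.comp hreal

/-- Subordination: the symbol `(2π|ξ|)^s` times a superposition of Gaussians is constant in `ξ ≠ 0`. -/
theorem integral_Ioi_rpow_mul_exp_neg_mul_sq {s : ℝ} (hs : 0 < s) {r : ℝ} (hr : 0 < r) :
    ∫ b in Ioi (0 : ℝ), b ^ (s / 2 - 1) * ((2 * Real.pi * r) ^ s * Real.exp (-(b * r ^ 2))) =
      (2 * Real.pi) ^ s * Real.Gamma (s / 2) := by
  have h := Real.integral_rpow_mul_exp_neg_mul_Ioi (half_pos hs) (pow_pos hr 2)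
  have e : (1 / r ^ 2) ^ (s / 2) = (r ^ s)⁻¹ := by
    rw [one_div, Real.inv_rpow (by positivity), ← Real.rpow_natCast, ← Real.rpow_mul hr.le]
    congr 2
    push_cast; ring
  rw [e] at h
  calc _ = ∫ b in Ioi (0 : ℝ), (2 * Real.pi * r) ^ s *
        (b ^ (s / 2 - 1) * Real.exp (-(r ^ 2 * b))) := by
        refine integral_congr_ae (Filter.Eventually.of_forall fun b => ?_)
        simp only [mul_comm b]
        ring
    _ = _ := by
        rw [integral_const_mul, h, Real.mul_rpow (by positivity) hr.le]
        have : r ^ s ≠ 0 := (Real.rpow_pos_of_pos hr s).ne'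
        field_simp

variable [FiniteDimensional ℝ E] [MeasurableSpace E] [BorelSpace E]

/-- The Gaussian multiplier acts on a Schwartz function as convolution with the heat kernel. -/
theorem fourier_gaussian_smul_fourierInv {b : ℝ} (hb : 0 < b) (ψ : 𝓢(E, ℂ)) (y : E) :
    𝓕 (smulLeftCLM ℂ (fun ξ : E => ((Real.exp (-(b * ‖ξ‖ ^ 2)) : ℝ) : ℂ)) (𝓕⁻ ψ)) y =
      ∫ x, (gaussianKernel b (x - y) : ℂ) * ψ x := by
  have hb' : 0 < (b : ℂ).re := by simpa
  have J : Integrable (fun w : E => Complex.exp (-b * ‖w‖ ^ 2 + 2 * Real.pi * Complex.I *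
      (inner ℝ y w : ℝ))) :=
    GaussianFourier.integrable_cexp_neg_mul_sq_norm_add hb' _ _
  have key := VectorFourier.integral_fourierIntegral_smul_eq_flip (L := innerₗ E)
      Real.continuous_fourierChar continuous_inner J (ψ.integrable (μ := volume))
  have lhs : ∀ w : E, VectorFourier.fourierIntegral Real.fourierChar volume (innerₗ E)
      (fun w : E => Complex.exp (-b * ‖w‖ ^ 2 + 2 * Real.pi * Complex.I * (inner ℝ y w : ℝ))) w =
      (gaussianKernel b (w - y) : ℂ) := by
    intro w
    refine (fourier_gaussian_innerProductSpace' hb' y w).trans ?_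
    rw [gaussianKernel, norm_sub_rev y w]
    push_cast
    rw [Complex.ofReal_cpow (by positivity)]
    push_cast
    congr 2
    ring
  have rhs : ∀ w : E, VectorFourier.fourierIntegral Real.fourierChar volume (innerₗ E).flip
      ψ w = 𝓕⁻ ψ (-w) := by
    intro w
    rw [SchwartzMap.fourierInv_coe, Real.fourierInv_eq_fourier_neg, neg_neg,
      Real.fourier_eq, VectorFourier.fourierIntegral]
    simp [real_inner_comm]
  simp only [lhs, rhs, smul_eq_mul] at key
  rw [key, SchwartzMap.fourier_coe, Real.fourier_eq', ← integral_neg_eq_self]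
  refine integral_congr_ae (Filter.Eventually.of_forall fun w => ?_)
  simp only [smulLeftCLM_apply_apply (hasTemperateGrowth_gaussian hb.le), smul_eq_mul, norm_neg,
    ← mul_assoc]
  rw [Complex.ofReal_exp, ← Complex.exp_add]
  congr 2
  push_cast [inner_neg_left, real_inner_comm]
  ring

theorem enorm_fourier_gaussian_smul_fourierInv_le {b : ℝ} (hb : 0 < b) (ψ : 𝓢(E, ℂ)) (y : E) :
    ‖𝓕 (smulLeftCLM ℂ (fun ξ : E => ((Real.exp (-(b * ‖ξ‖ ^ 2)) : ℝ) : ℂ)) (𝓕⁻ ψ)) y‖ₑ ≤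
      ∫⁻ x, ENNReal.ofReal (gaussianKernel b (x - y)) * ‖ψ x‖ₑ := by
  rw [fourier_gaussian_smul_fourierInv hb]
  refine (enorm_integral_le_lintegral_enorm _).trans (le_of_eq (lintegral_congr fun x => ?_))
  have h0 : 0 ≤ gaussianKernel b (x - y) := by
    unfold gaussianKernel
    positivity
  rw [enorm_mul, ← ofReal_norm (gaussianKernel b (x - y) : ℂ), Complex.norm_real,
    Real.norm_of_nonneg h0]

/-- Parseval's identity for the bilinear pairing of `L²` with Schwartz functions. -/
theorem integral_mul_eq_integral_fourier_mul_fourierInv (u : Lp ℂ 2 (volume : Measure E))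
    (ψ : 𝓢(E, ℂ)) :
    ∫ x, u x * ψ x = ∫ ξ, (𝓕 u : Lp ℂ 2 (volume : Measure E)) ξ * 𝓕⁻ ψ ξ := by
  have h := congrArg (fun T => T (𝓕⁻ ψ)) (Lp.fourier_toTemperedDistribution_eq u)
  simp only [TemperedDistribution.fourier_apply, FourierTransform.fourier_fourierInv_eq,
    Lp.toTemperedDistribution_apply, smul_eq_mul] at h
  simpa only [mul_comm] using h

end Fourier

/-! ### From weak to pointwise bounds -/

section Pointwise
open Set Metric Module

variable {E : Type*} [NormedAddCommGroup E] [InnerProductSpace ℝ E]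
  [FiniteDimensional ℝ E] [MeasurableSpace E] [BorelSpace E]

/-- A bound for the pairings with all Schwartz functions is a pointwise bound almost everywhere:
test with shrinking bump functions and use Lebesgue's differentiation theorem. -/
theorem ae_enorm_le_of_forall_schwartz {u : E → ℂ} (hu : LocallyIntegrable u volume)
    {H : E → ℝ≥0∞} (hH : ∀ᵐ x, H x ≠ ∞)
    (hHi : LocallyIntegrable (fun x => (H x).toReal) volume)
    (h : ∀ ψ : 𝓢(E, ℂ), ‖∫ x, u x * ψ x‖ₑ ≤ ∫⁻ x, H x * ‖ψ x‖ₑ) :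
    ∀ᵐ x, ‖u x‖ₑ ≤ H x := by
  let φ : ℕ → ContDiffBump (0 : E) := fun k =>
    ⟨1 / ((k : ℝ) + 1), 2 * (1 / ((k : ℝ) + 1)), by positivity, by
      have : 0 < 1 / ((k : ℝ) + 1) := by positivity
      linarith⟩
  have hφ : Filter.Tendsto (fun k => (φ k).rOut) Filter.atTop (nhds 0) := by
    simpa only [mul_zero] using
      (tendsto_one_div_add_atTop_nhds_zero_nat (𝕜 := ℝ)).const_mul (2 : ℝ)
  have hφ' : ∀ᶠ k in Filter.atTop, (φ k).rOut ≤ 2 * (φ k).rIn :=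
    Filter.Eventually.of_forall fun k => le_rfl
  filter_upwards [hH, ContDiffBump.ae_convolution_tendsto_right_of_locallyIntegrable hφ hφ' hu,
    ContDiffBump.ae_convolution_tendsto_right_of_locallyIntegrable hφ hφ' hHi] with x hx hux hHx
  have hle : ‖u x‖ ≤ (H x).toReal := by
    refine le_of_tendsto_of_tendsto' hux.norm hHx fun k => ?_
    simp only [convolution_eq_swap, ContinuousLinearMap.lsmul_apply, smul_eq_mul]
    set w : E → ℝ := fun y => (φ k).normed volume (x - y) with hw
    have hw0 : ∀ y, 0 ≤ w y := fun y => (φ k).nonneg_normed _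
    have hws : HasCompactSupport w :=
      ((φ k).hasCompactSupport_normed (μ := volume)).comp_homeomorph (Homeomorph.subLeft x)
    have hwc : ContDiff ℝ ((⊤ : ℕ∞) : WithTop ℕ∞) w :=
      ((φ k).contDiff_normed (μ := volume)).comp (contDiff_const.sub contDiff_id)
    have hwcs : HasCompactSupport (fun y => (w y : ℂ)) := hws.comp_left (g := Complex.ofReal) rfl
    have hwcc : ContDiff ℝ ((⊤ : ℕ∞) : WithTop ℕ∞) (fun y => (w y : ℂ)) :=
      Complex.ofRealCLM.contDiff.comp hwc
    have hint : Integrable (fun y => w y * (H y).toReal) :=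
      hHi.integrable_smul_left_of_hasCompactSupport hwc.continuous hws
    have hψ := h (hwcs.toSchwartzMap hwcc)
    have e1 : ∫ y, u y * hwcs.toSchwartzMap hwcc y = ∫ y, w y • u y := by
      refine integral_congr_ae (Filter.Eventually.of_forall fun y => ?_)
      simp [mul_comm]
    have e2 : ∫⁻ y, H y * ‖hwcs.toSchwartzMap hwcc y‖ₑ =
        ENNReal.ofReal (∫ y, w y * (H y).toReal) := by
      rw [ofReal_integral_eq_lintegral_ofReal hint
        (Filter.Eventually.of_forall fun y => mul_nonneg (hw0 y) ENNReal.toReal_nonneg)]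
      refine lintegral_congr_ae ?_
      filter_upwards [hH] with y hy
      rw [ENNReal.ofReal_mul (hw0 y), ENNReal.ofReal_toReal hy, mul_comm]
      congr 1
      rw [← ofReal_norm]
      simp [abs_of_nonneg (hw0 y)]
    rw [e1, e2, ← ofReal_norm] at hψ
    exact (ENNReal.ofReal_le_ofReal_iff
      (integral_nonneg fun y => mul_nonneg (hw0 y) ENNReal.toReal_nonneg)).1 hψ
  rw [← ofReal_norm]
  exact ENNReal.ofReal_le_of_le_toReal hle

end Pointwise

/-! ### The fractional Sobolev inequality -/

section FractionalLaplacian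
open Set Metric Module

variable {n : ℕ}

/-- In the weak sense, `u` is dominated by a constant times the heat potential of
`f = (-Δ)^(s/2) u`. -/
theorem enorm_integral_mul_le_lintegral_heatPotential {s : ℝ} (hs : 0 < s)
    {u : Lp ℂ 2 (volume : Measure (EuclideanSpace ℝ (Fin n)))}
    {f : EuclideanSpace ℝ (Fin n) → ℂ} (hn : 0 < n)
    (hf : Measurable f) (hfu : IsFractionalLaplacian s u f)
    (ψ : 𝓢(EuclideanSpace ℝ (Fin n), ℂ)) :
    ENNReal.ofReal ((2 * Real.pi) ^ s * Real.Gamma (s / 2)) * ‖∫ x, u x * ψ x‖ₑ ≤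
      ∫⁻ x, heatPotential volume s (fun y => ‖f y‖ₑ) x * ‖ψ x‖ₑ := by
  have : Nonempty (Fin n) := ⟨⟨0, hn⟩⟩
  set c : ℝ := (2 * Real.pi) ^ s * Real.Gamma (s / 2) with hc
  have hπ := Real.pi_pos
  have hc0 : 0 < c := mul_pos (by positivity) (Real.Gamma_pos_of_pos (by linarith))
  set v : Lp ℂ 2 (volume : Measure (EuclideanSpace ℝ (Fin n))) := 𝓕 u with hv
  set W : EuclideanSpace ℝ (Fin n) → ℂ := fun ξ => v ξ * 𝓕⁻ ψ ξ with hW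
  have hWi : Integrable W := (Lp.memLp v).integrable_mul ((𝓕⁻ ψ).memLp 2)
  set k : EuclideanSpace ℝ (Fin n) → ℝ → ℝ := fun ξ b =>
    b ^ (s / 2 - 1) * ((2 * Real.pi * ‖ξ‖) ^ s * Real.exp (-(b * ‖ξ‖ ^ 2))) with hk
  have hk0 : ∀ ξ, ∀ b ∈ Ioi (0 : ℝ), 0 ≤ k ξ b := fun ξ b hb => by
    have : (0 : ℝ) < b := hb
    positivity
  have hkm : Measurable (fun z : EuclideanSpace ℝ (Fin n) × ℝ => k z.1 z.2) := by
    simp only [hk]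
    fun_prop
  have hkint : ∀ᵐ ξ : EuclideanSpace ℝ (Fin n), ∫ b in Ioi (0 : ℝ), k ξ b = c := by
    filter_upwards [Measure.ae_ne volume (0 : EuclideanSpace ℝ (Fin n))] with ξ hξ
    exact integral_Ioi_rpow_mul_exp_neg_mul_sq hs (norm_pos_iff.2 hξ)
  have hkI : ∀ᵐ ξ : EuclideanSpace ℝ (Fin n), IntegrableOn (k ξ) (Ioi 0) := by
    filter_upwards [hkint] with ξ hξ
    by_contra hcon
    rw [integral_undef hcon] at hξ
    exact hc0.ne hξ
  -- integrability on the product is what the upper bound `c * |W|` for the inner integral gives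
  have hprod : Integrable (fun z : EuclideanSpace ℝ (Fin n) × ℝ => W z.1 * (k z.1 z.2 : ℂ))
      (volume.prod (volume.restrict (Ioi 0))) := by
    rw [integrable_prod_iff]
    · constructor
      · filter_upwards [hkI] with ξ hξ using (Integrable.ofReal hξ).const_mul _
      · refine (hWi.norm.mul_const c).congr ?_
        filter_upwards [hkint] with ξ hξ
        rw [← hξ, ← integral_const_mul]
        refine setIntegral_congr_fun measurableSet_Ioi fun b hb => ?_
        simp [abs_of_nonneg (hk0 ξ b hb)]
    · exact (hWi.aestronglyMeasurable.comp_fst).mul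
        (Complex.measurable_ofReal.comp hkm).aestronglyMeasurable
  -- the test function that turns the symbol of the fractional Laplacian into the heat kernel
  set φ : ℝ → 𝓢(EuclideanSpace ℝ (Fin n), ℂ) := fun b =>
    smulLeftCLM ℂ (fun ξ : EuclideanSpace ℝ (Fin n) => ((Real.exp (-(b * ‖ξ‖ ^ 2)) : ℝ) : ℂ))
      (𝓕⁻ ψ) with hφ
  have hslice : ∀ b ∈ Ioi (0 : ℝ), ∫ ξ, W ξ * (k ξ b : ℂ) =
      ((b ^ (s / 2 - 1) : ℝ) : ℂ) * ∫ y, f y * 𝓕 (φ b) y := by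
    intro b hb
    rw [hfu (φ b), ← integral_const_mul]
    refine integral_congr_ae (Filter.Eventually.of_forall fun ξ => ?_)
    simp only [hW, hk, hφ, smulLeftCLM_apply_apply (hasTemperateGrowth_gaussian (le_of_lt hb)),
      smul_eq_mul, Complex.ofReal_mul]
    ring
  have hrepr : (c : ℂ) * ∫ x, u x * ψ x =
      ∫ b in Ioi (0 : ℝ), ((b ^ (s / 2 - 1) : ℝ) : ℂ) * ∫ y, f y * 𝓕 (φ b) y := by
    rw [← setIntegral_congr_fun measurableSet_Ioi hslice, ← integral_integral_swap hprod,
      integral_mul_eq_integral_fourier_mul_fourierInv, ← integral_const_mul]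
    refine integral_congr_ae ?_
    filter_upwards [hkint] with ξ hξ
    have hkC : ∫ b in Ioi (0 : ℝ), (k ξ b : ℂ) = c := by
      rw [← hξ]
      exact integral_ofReal
    rw [integral_const_mul, hkC, mul_comm]
  calc ENNReal.ofReal c * ‖∫ x, u x * ψ x‖ₑ = ‖(c : ℂ) * ∫ x, u x * ψ x‖ₑ := by
        rw [enorm_mul, ← ofReal_norm (c : ℂ), Complex.norm_real, Real.norm_of_nonneg hc0.le]
    _ ≤ ∫⁻ b in Ioi (0 : ℝ), ENNReal.ofReal (b ^ (s / 2 - 1)) *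
          ∫⁻ y, ‖f y‖ₑ * ∫⁻ x, ENNReal.ofReal (gaussianKernel b (x - y)) * ‖ψ x‖ₑ := by
        rw [hrepr]
        refine (enorm_integral_le_lintegral_enorm _).trans
          (setLIntegral_mono' measurableSet_Ioi fun b hb => ?_)
        have hb0 : (0 : ℝ) < b := hb
        rw [enorm_mul, ← ofReal_norm ((b ^ (s / 2 - 1) : ℝ) : ℂ), Complex.norm_real,
          Real.norm_of_nonneg (by positivity)]
        gcongr
        refine (enorm_integral_le_lintegral_enorm _).trans (lintegral_mono fun y => ?_)
        rw [enorm_mul]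
        gcongr
        exact enorm_fourier_gaussian_smul_fourierInv_le hb0 ψ y
    _ = _ := (lintegral_heatPotential_mul s hf.enorm (ψ.continuous.measurable.enorm)).symm

/-- The fractional Sobolev inequality `‖u‖_r ≤ C ‖(-Δ)^(s/2) u‖_p` with `1 / r = 1 / p - s / n`. -/
theorem lintegral_rpow_le_of_isFractionalLaplacian {s p r : ℝ} (hn : 0 < n) (hs : 0 < s)
    (hp : 1 < p) (hr : 0 < r) (hrp : 1 / r = 1 / p - s / n) :
    ∃ C : ℝ≥0∞, C ≠ ∞ ∧ ∀ (u : Lp ℂ 2 (volume : Measure (EuclideanSpace ℝ (Fin n))))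
      (f : EuclideanSpace ℝ (Fin n) → ℂ), MemLp f (ENNReal.ofReal p) volume →
      IsFractionalLaplacian s u f →
      ∫⁻ x, ‖u x‖ₑ ^ r ≤ C * (∫⁻ x, ‖f x‖ₑ ^ p) ^ (r / p) := by
  have : Nonempty (Fin n) := ⟨⟨0, hn⟩⟩
  have hp0 : 0 < p := by linarith
  obtain ⟨C₀, hC₀, hHLS⟩ := lintegral_heatPotential_rpow_le
    (E := EuclideanSpace ℝ (Fin n)) (μ := volume) hs hp hr (by simpa using hrp)
  set c : ℝ≥0∞ := ENNReal.ofReal ((2 * Real.pi) ^ s * Real.Gamma (s / 2)) with hc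
  have hπ := Real.pi_pos
  have hc0 : c ≠ 0 := by
    have : 0 < (2 * Real.pi) ^ s * Real.Gamma (s / 2) :=
      mul_pos (by positivity) (Real.Gamma_pos_of_pos (by linarith))
    simpa [hc] using this
  have hct : c ≠ ∞ := ENNReal.ofReal_ne_top
  have hr1 : 1 ≤ r := by
    have h1 : 0 ≤ s / n := by positivity
    have h2 : 1 / r ≤ 1 := by
      rw [hrp]
      have := (div_le_one hp0).2 hp.le
      linarith
    exact (div_le_one hr).1 h2
  refine ⟨c⁻¹ ^ r * C₀, ENNReal.mul_ne_top
    (ENNReal.rpow_ne_top_of_nonneg hr.le (ENNReal.inv_ne_top.2 hc0)) hC₀, fun u f hf hfu => ?_⟩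
  -- pass to a Borel representative of `f`
  set f' := hf.1.mk f with hf'
  have hff' : f =ᵐ[volume] f' := hf.1.ae_eq_mk
  have hfm : Measurable f' := hf.1.stronglyMeasurable_mk.measurable
  have hfu' : IsFractionalLaplacian s u f' := fun φ => by
    rw [← hfu φ]
    refine integral_congr_ae ?_
    filter_upwards [hff'] with x hx
    rw [hx]
  have hIeq : ∫⁻ x, ‖f x‖ₑ ^ p = ∫⁻ x, ‖f' x‖ₑ ^ p := by
    refine lintegral_congr_ae ?_
    filter_upwards [hff'] with x hx
    rw [hx]
  have hIt : ∫⁻ x, ‖f' x‖ₑ ^ p ≠ ∞ := by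
    rw [← hIeq]
    have := lintegral_rpow_enorm_lt_top_of_eLpNorm_lt_top (by simpa using hp0)
      ENNReal.ofReal_ne_top hf.2
    rw [ENNReal.toReal_ofReal hp0.le] at this
    exact this.ne
  set P := heatPotential volume s (fun y => ‖f' y‖ₑ) with hP
  have hPm : Measurable P := measurable_heatPotential s (by fun_prop)
  have hPr : ∫⁻ x, P x ^ r ≤ C₀ * (∫⁻ x, ‖f' x‖ₑ ^ p) ^ (r / p) := hHLS _ (by fun_prop) hIt
  have hPrt : ∫⁻ x, P x ^ r ≠ ∞ := ne_top_of_le_ne_top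
    (ENNReal.mul_ne_top hC₀ (ENNReal.rpow_ne_top_of_nonneg (by positivity) hIt)) hPr
  have hPfin : ∀ᵐ x, P x ≠ ∞ := by
    filter_upwards [ae_lt_top (hPm.pow_const r) hPrt] with x hx hxt
    rw [hxt, ENNReal.top_rpow_of_pos hr] at hx
    exact lt_irrefl _ hx
  have hcP : ∀ᵐ x, c⁻¹ * P x ≠ ∞ := by
    filter_upwards [hPfin] with x hx using ENNReal.mul_ne_top (ENNReal.inv_ne_top.2 hc0) hx
  have hPL : MemLp (fun x => (P x).toReal) (ENNReal.ofReal r) volume := by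
    refine ⟨hPm.ennreal_toReal.aestronglyMeasurable, ?_⟩
    rw [eLpNorm_lt_top_iff_lintegral_rpow_enorm_lt_top (by simpa using hr) ENNReal.ofReal_ne_top,
      ENNReal.toReal_ofReal hr.le]
    refine lt_of_le_of_lt (lintegral_mono fun x => ?_) (lt_top_iff_ne_top.2 hPrt)
    gcongr
    rw [Real.enorm_of_nonneg ENNReal.toReal_nonneg]
    exact ENNReal.ofReal_toReal_le
  have hloc : LocallyIntegrable (fun x => (c⁻¹ * P x).toReal) volume := by
    simp only [ENNReal.toReal_mul]
    exact (hPL.locallyIntegrable (by simpa using hr1)).smul c⁻¹.toReal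
  have hpt : ∀ᵐ x, ‖u x‖ₑ ≤ c⁻¹ * P x := by
    refine ae_enorm_le_of_forall_schwartz ((Lp.memLp u).locallyIntegrable (by norm_num)) hcP hloc
      fun ψ => ?_
    have h := enorm_integral_mul_le_lintegral_heatPotential hs hn hfm hfu' ψ
    simp only [mul_assoc]
    rw [lintegral_const_mul' _ _ (ENNReal.inv_ne_top.2 hc0), mul_comm c⁻¹, ← div_eq_mul_inv,
      ENNReal.le_div_iff_mul_le (Or.inl hc0) (Or.inl hct), mul_comm]
    exact h
  calc ∫⁻ x, ‖u x‖ₑ ^ r ≤ ∫⁻ x, c⁻¹ ^ r * P x ^ r := by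
        refine lintegral_mono_ae ?_
        filter_upwards [hpt] with x hx
        rw [← ENNReal.mul_rpow_of_nonneg _ _ hr.le]
        gcongr
    _ = c⁻¹ ^ r * ∫⁻ x, P x ^ r := lintegral_const_mul _ (hPm.pow_const _)
    _ ≤ _ := by
        rw [hIeq, mul_assoc]
        gcongr

end FractionalLaplacian

/-! ### Interpolation and the Gagliardo–Nirenberg inequality -/

section Interpolation
open Set

/-- Hölder's inequality for `g ^ (a + b)`, allowing `b` and `r` to be both negative. Where `g = 0`
and `b < 0` the integrand `g ^ a * g ^ b` is `0 * ∞ = 0`, so that `0 < a + b` is needed. -/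
theorem lintegral_rpow_add_le_mul {α : Type*} [MeasurableSpace α] {μ : Measure α} {g : α → ℝ≥0∞}
    (hg : AEMeasurable g μ) {a b R r : ℝ} (ha : 0 < a) (hab : 0 < a + b)
    (hb : b ≠ 0) (hrb : 0 < r / b) (hR : 0 < R) (hsum : a / R + b / r = 1)
    (hgt : ∀ x, g x ≠ ∞) :
    ∫⁻ x, g x ^ (a + b) ∂μ ≤
      (∫⁻ x, g x ^ R ∂μ) ^ (a / R) * (∫⁻ x, g x ^ r ∂μ) ^ (b / r) := by
  have hconj : (R / a).HolderConjugate (r / b) :=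
    ⟨by rw [inv_div, inv_div, hsum, inv_one], by positivity, hrb⟩
  have h := ENNReal.lintegral_mul_le_Lp_mul_Lq μ hconj (hg.pow_const a) (hg.pow_const b)
  have ea : ∀ x, (g x ^ a) ^ (R / a) = g x ^ R := fun x => by
    rw [← ENNReal.rpow_mul, mul_div_cancel₀ _ ha.ne']
  have eb : ∀ x, (g x ^ b) ^ (r / b) = g x ^ r := fun x => by
    rw [← ENNReal.rpow_mul, mul_div_cancel₀ _ hb]
  simp only [ea, eb, one_div_div, Pi.mul_apply] at h
  refine (lintegral_mono fun x => ?_).trans h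
  by_cases hx : g x = 0
  · simp [hx, ENNReal.zero_rpow_of_pos hab]
  · rw [ENNReal.rpow_add _ _ hx (hgt x)]

/-- Negative powers of an `L²` function on a space of infinite measure have infinite integral,
since the function is less than `1` on a set of infinite measure. -/
theorem lintegral_enorm_rpow_eq_top {E : Type*} [MeasurableSpace E] {μ : Measure E}
    (hμ : μ univ = ∞) {u : E → ℂ} (hu : MemLp u 2 μ) {r : ℝ} (hr : r < 0) :
    ∫⁻ x, ‖u x‖ₑ ^ r ∂μ = ∞ := by
  have hfin : μ {x | 1 ≤ ‖u x‖ₑ} < ∞ := by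
    exact hu.meas_ge_lt_top'_enorm two_ne_zero ENNReal.ofNat_ne_top one_ne_zero (by simp)
  have hcompl : μ {x | 1 ≤ ‖u x‖ₑ}ᶜ = ∞ := by
    by_contra hcon
    have := measure_union_le (μ := μ) {x | 1 ≤ ‖u x‖ₑ} {x | 1 ≤ ‖u x‖ₑ}ᶜ
    rw [union_compl_self, hμ, top_le_iff] at this
    exact (ENNReal.add_ne_top.2 ⟨hfin.ne, hcon⟩) this
  rw [eq_top_iff, ← hcompl]
  refine meas_le_lintegral₀ (hu.1.enorm.pow_const r) fun x hx => ?_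
  simp only [mem_compl_iff, mem_ofPred_eq, not_le] at hx
  rcases eq_or_ne (‖u x‖ₑ) 0 with h0 | h0
  · simp [h0, ENNReal.zero_rpow_of_neg hr]
  · exact ENNReal.one_le_rpow_of_pos_of_le_one_of_neg (pos_iff_ne_zero.2 h0) hx.le hr

end Interpolation

/-- The Gagliardo–Nirenberg inequality in terms of `a = m θ`, the only combination of `m` and `θ`
that it involves. -/
theorem exists_gagliardo_nirenberg {n : ℕ} {s p : ℝ} (hn : 0 < n) (hs : 0 < s) (hp : 1 < p)
    (hpn : p < n / s) {a q r : ℝ} (ha : 0 < a) (hqa : q ≠ a) (hq0 : q ≠ 0)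
    (hr : 1 < r / (q - a)) (hscale : a * (1 / p - s / n) + (q - a) / r = 1) :
    ∃ C : ℝ, 0 < C ∧
      ∀ (u : Lp ℂ 2 (volume : Measure (EuclideanSpace ℝ (Fin n))))
        (f : EuclideanSpace ℝ (Fin n) → ℂ),
        (q < 0 → u ≠ 0) → MemLp f (ENNReal.ofReal p) volume → IsFractionalLaplacian s u f →
        ∫⁻ x, ‖u x‖ₑ ^ q ≤
          ENNReal.ofReal C * (∫⁻ x, ‖f x‖ₑ ^ p) ^ (a / p) *
            (∫⁻ x, ‖u x‖ₑ ^ r) ^ ((q - a) / r) := by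
  have : Nonempty (Fin n) := ⟨⟨0, hn⟩⟩
  have hn' : (0 : ℝ) < n := by exact_mod_cast hn
  have hp0 : 0 < p := by linarith
  have hexp : 0 < 1 / p - s / n := by
    rw [lt_div_iff₀ hs] at hpn
    rw [sub_pos, div_lt_div_iff₀ hn' hp0]
    linarith
  set R : ℝ := 1 / (1 / p - s / n) with hR
  have hR0 : 0 < R := one_div_pos.2 hexp
  have haR : a / R = a * (1 / p - s / n) := by rw [hR, div_div_eq_mul_div, div_one]
  have hrb : 0 < r / (q - a) := by linarith
  have hbr : 0 < (q - a) / r := by rw [← inv_div]; exact inv_pos.2 hrb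
  obtain ⟨C₀, hC₀, hsob⟩ := lintegral_rpow_le_of_isFractionalLaplacian hn hs hp hR0
    (by rw [hR, one_div_one_div])
  have hC₁ : C₀ ^ (a / R) ≠ ∞ := ENNReal.rpow_ne_top_of_nonneg (by positivity) hC₀
  have hCpos : 0 < (C₀ ^ (a / R)).toReal + 1 := by positivity
  refine ⟨(C₀ ^ (a / R)).toReal + 1, hCpos, fun u f hu hf hfu => ?_⟩
  rcases lt_or_gt_of_ne hq0 with hq | hq
  · -- here `r < 0`, so the last factor is infinite, and the first one is positive since `u ≠ 0`
    have hr0 : r < 0 := by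
      by_contra hcon
      exact absurd hrb (not_lt.2 (div_nonpos_of_nonneg_of_nonpos (not_lt.1 hcon) (by linarith)))
    have hI : ∫⁻ x, ‖f x‖ₑ ^ p ≠ 0 := by
      intro h0
      have h1 := hsob u f hf hfu
      rw [h0, ENNReal.zero_rpow_of_pos (by positivity), mul_zero, nonpos_iff_eq_zero,
        lintegral_eq_zero_iff' ((Lp.aestronglyMeasurable u).enorm.pow_const R)] at h1
      refine hu hq ((Lp.eq_zero_iff_ae_eq_zero).2 ?_)
      filter_upwards [h1] with x hx
      simpa [hR0, hR0.not_gt] using hx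
    have hne : (∫⁻ x, ‖f x‖ₑ ^ p) ^ (a / p) ≠ 0 := by
      have hap : 0 < a / p := by positivity
      simp [ENNReal.rpow_eq_zero_iff, hI, hap.not_gt]
    rw [lintegral_enorm_rpow_eq_top (measure_univ_of_isAddLeftInvariant _) (Lp.memLp u) hr0,
      ENNReal.top_rpow_of_pos hbr, ENNReal.mul_top]
    · exact le_top
    · exact mul_ne_zero (by simpa using hCpos) hne
  · have hH := lintegral_rpow_add_le_mul (Lp.aestronglyMeasurable u).enorm (b := q - a) (r := r)
      ha (by linarith) (sub_ne_zero.2 hqa) hrb hR0 (by rw [haR, hscale]) fun x => enorm_ne_top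
    rw [add_sub_cancel] at hH
    refine hH.trans ?_
    gcongr
    calc (∫⁻ x, ‖u x‖ₑ ^ R) ^ (a / R)
        ≤ (C₀ * (∫⁻ x, ‖f x‖ₑ ^ p) ^ (R / p)) ^ (a / R) := by
          gcongr
          exact hsob u f hf hfu
      _ = C₀ ^ (a / R) * (∫⁻ x, ‖f x‖ₑ ^ p) ^ (a / p) := by
          rw [ENNReal.mul_rpow_of_nonneg _ _ (by positivity), ← ENNReal.rpow_mul]
          congr 2
          field_simp
      _ ≤ _ := by
          gcongr
          rw [ENNReal.le_ofReal_iff_toReal_le hC₁ hCpos.le]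
          linarith

theorem theorem2p2 (n : ℕ) (s p : ℝ) (hs : 0 < s) (hsn : s < n) (hp : 1 < p) (hpn : p < n / s) :
    (∀ m q θ r : ℝ, m ≠ 0 → q ≠ 0 → θ ≠ 0 → q ≠ m * θ → 0 < m * θ → 1 < r / (q - m * θ) →
      m * θ * (1 / p - s / n) + (q - m * θ) / r = 1 →
      ∃ C : ℝ, 0 < C ∧
        ∀ (u : Lp ℂ 2 (volume : Measure (EuclideanSpace ℝ (Fin n))))
          (f : EuclideanSpace ℝ (Fin n) → ℂ),
          (q < 0 → u ≠ 0) → MemLp f (ENNReal.ofReal p) volume → IsFractionalLaplacian s u f →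
          ∫⁻ x, ‖u x‖ₑ ^ q ≤
            ENNReal.ofReal C * (∫⁻ x, ‖f x‖ₑ ^ p) ^ (m * θ / p) *
              (∫⁻ x, ‖u x‖ₑ ^ r) ^ ((q - m * θ) / r)) ∧
    (∀ q θ r : ℝ, q ≠ 0 → θ ≠ 0 → q ≠ q * θ → 0 < q * θ → 1 < r / (q - q * θ) →
      θ * (1 / p - s / n) + (1 - θ) / r = 1 / q →
      ∃ C : ℝ, 0 < C ∧
        ∀ (u : Lp ℂ 2 (volume : Measure (EuclideanSpace ℝ (Fin n))))
          (f : EuclideanSpace ℝ (Fin n) → ℂ),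
          (q < 0 → u ≠ 0) → MemLp f (ENNReal.ofReal p) volume → IsFractionalLaplacian s u f →
          (∫⁻ x, ‖u x‖ₑ ^ q) ^ (1 / q) ≤
            ENNReal.ofReal C * (∫⁻ x, ‖f x‖ₑ ^ p) ^ (θ / p) *
              (∫⁻ x, ‖u x‖ₑ ^ r) ^ ((1 - θ) / r)) := by
  have hn : 0 < n := by exact_mod_cast hs.trans hsn
  refine ⟨fun m q θ r _ hq _ hqm hmθ hr hscale =>
    exists_gagliardo_nirenberg hn hs hp hpn hmθ hqm hq hr hscale,
    fun q θ r hq _ hqθ hqθ0 hr hscale => ?_⟩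
  rcases lt_or_gt_of_ne hq with hqn | hqp
  · -- for `q < 0` the integral `∫ |u|^q` is infinite, so that its power `1 / q` vanishes
    have : Nonempty (Fin n) := ⟨⟨0, hn⟩⟩
    refine ⟨1, one_pos, fun u f _ _ _ => ?_⟩
    rw [lintegral_enorm_rpow_eq_top (measure_univ_of_isAddLeftInvariant _) (Lp.memLp u) hqn,
      ENNReal.top_rpow_of_neg (one_div_neg.2 hqn)]
    exact zero_le
  · have hscale' : q * θ * (1 / p - s / n) + (q - q * θ) / r = 1 := by
      have : q * (θ * (1 / p - s / n) + (1 - θ) / r) = q * (1 / q) := by rw [hscale]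
      rw [mul_one_div_cancel hq] at this
      exact Eq.trans (by ring) this
    obtain ⟨C, hC, h⟩ := exists_gagliardo_nirenberg hn hs hp hpn hqθ0 hqθ hq hr hscale'
    refine ⟨C ^ (1 / q), by positivity, fun u f hu hf hfu => ?_⟩
    have hq1 : 0 ≤ 1 / q := by positivity
    have e1 : q * θ / p * (1 / q) = θ / p := by field_simp
    have e2 : (q - q * θ) / r * (1 / q) = (1 - θ) / r := by field_simp
    have := ENNReal.rpow_le_rpow (h u f hu hf hfu) hq1
    rwa [ENNReal.mul_rpow_of_nonneg _ _ hq1, ENNReal.mul_rpow_of_nonneg _ _ hq1,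
      ← ENNReal.rpow_mul, ← ENNReal.rpow_mul, e1, e2, ENNReal.ofReal_rpow_of_pos hC] at this
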